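/- Let $n\ge 1$, let $\Omega\subset\mathbb{R}^n$ be a bounded domain with $C^\infty$ boundary (the origin may lie inside $\Omega$, on $\partial\Omega$, or outside $\overline\Omega$), and let $p>1$ and $s,b\in\mathbb{R}$ satisfy $s>n-np$ and $b>-n$. Let $$D_0=\{u\in C^2(\overline\Omega) : u=0 \text{ on } \partial\Omega,\ \Delta u\equiv 0 \text{ on a neighborhood of the origin}\},$$ and let $W^{2,p}_N(\Omega,|x|^{-s}dx)$ be the completion of $D_0$ with respect to the norm $\|u\|_s=\left(\int_\Omega |x|^{-s}|\Delta u|^p\,dx\right)^{1/p}$. It is regarded as a space of functions in $L^1(\Omega)$: its elements are the $L^1(\Omega)$-limits $u$ of $\|\cdot\|_s$-Cauchy sequences $(u_k)$ in $D_0$, and $\Delta u$ is the limit of $\Delta u_k$ in $L^p(\Omega,|x|^{-s}dx)$, which is the distributional Laplacian of $u$. If $s+b+2p\ge 0$, then $$\Lambda(s,b):=\inf_{\substack{u\in W^{2,p}_N(\Omega,|x|^{-s}dx)\\ u\ne 0}}\frac{\int_\Omega |x|^{-s}|\Delta u|^p\,dx}{\int_\Omega |x|^{b}|u|^p\,dx}>0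 .$$ Consequently $W^{2,p}_N(\Omega,|x|^{-s}dx)$ is continuously embedded into $L^p(\Omega,|x|^b dx)$: there is a constant $C\geq 0$ such that every $u\in W^{2,p}_N(\Omega,|x|^{-s}dx)$ satisfies $u\in L^p(\Omega,|x|^bdx)$ and $\left(\int_\Omega|x|^b|u|^p\,dx\right)^{1/p}\le C\left(\int_\Omega|x|^{-s}|\Delta u|^p\,dx\right)^{1/p}$. -/

import Mathlib

open MeasureTheory Filter Topology
open scoped ENNReal NNReal ContDiff

/-- A bounded smooth domain of `ℝⁿ`: a nonempty connected bounded open set which, near each of its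
boundary points, is the sublevel set `{ρ < 0}` of a `C^∞` function `ρ` with nonzero differential at
that point. -/
structure IsBoundedSmoothDomain {n : ℕ} (Ω : Set (EuclideanSpace ℝ (Fin n))) : Prop where
  isOpen : IsOpen Ω
  isConnected : IsConnected Ω
  isBounded : Bornology.IsBounded Ω
  smooth_boundary : ∀ x₀ ∈ frontier Ω, ∃ (V : Set (EuclideanSpace ℝ (Fin n)))
    (ρ : EuclideanSpace ℝ (Fin n) → ℝ), IsOpen V ∧ x₀ ∈ V ∧ ContDiffOn ℝ ∞ ρ V ∧
      fderiv ℝ ρ x₀ ≠ 0 ∧ Ω ∩ V = {x | x ∈ V ∧ ρ x < 0}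

/-- The measure `|x|^a dx` on `Ω`. -/
noncomputable def powMeasure {n : ℕ} (Ω : Set (EuclideanSpace ℝ (Fin n))) (a : ℝ) :
    Measure (EuclideanSpace ℝ (Fin n)) :=
  (volume.restrict Ω).withDensity (fun x => ENNReal.ofReal (‖x‖ ^ a))

/-- `C²_N(Ω̄)`: functions of class `C²` on the closure of `Ω` that vanish on the boundary.
Only the values on the closure of `Ω` matter. -/
def C2N {n : ℕ} (Ω : Set (EuclideanSpace ℝ (Fin n))) : Set (EuclideanSpace ℝ (Fin n) → ℝ) :=
  {u | ContDiffOn ℝ 2 u (closure Ω) ∧ ∀ x ∈ frontier Ω, u x = 0}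

/-- `D₀`: functions in `C²_N(Ω̄)` whose Laplacian vanishes (in `Ω`) near the origin. -/
def D0 {n : ℕ} (Ω : Set (EuclideanSpace ℝ (Fin n))) : Set (EuclideanSpace ℝ (Fin n) → ℝ) :=
  {u | u ∈ C2N Ω ∧ ∀ᶠ x in 𝓝 (0 : EuclideanSpace ℝ (Fin n)), x ∈ Ω → Laplacian.laplacian u x = 0}

/-- `MemNavier Ω p s u f` says that `u` belongs to `W^{2,p}_N(Ω, |x|^{-s} dx)` and that `Δu = f`.

The space is the completion of `D₀` for the norm `(∫_Ω |x|^{-s} |Δu|^p dx)^{1/p}`, realized as a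
space of integrable functions on `Ω` (up to a.e. equality): its elements are the `L¹(Ω)` limits `u`
of sequences `U k` in `D₀` that are Cauchy for this norm. By completeness of `L^p(Ω, |x|^{-s} dx)`,
the latter means that `Δ(U k)` converges there to some `f`; testing against `C_c^∞(Ω)` shows that
this `f` is the distributional Laplacian of `u`, and the norm of `u` in the completion is the norm
of `f` in `L^p(Ω, |x|^{-s} dx)`. -/
def MemNavier {n : ℕ} (Ω : Set (EuclideanSpace ℝ (Fin n))) (p s : ℝ)
    (u f : EuclideanSpace ℝ (Fin n) → ℝ) : Prop :=
  MemLp u 1 (volume.restrict Ω) ∧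
  MemLp f (ENNReal.ofReal p) (powMeasure Ω (-s)) ∧
  ∃ U : ℕ → EuclideanSpace ℝ (Fin n) → ℝ,
    (∀ k, U k ∈ D0 Ω) ∧
    Tendsto (fun k => eLpNorm (fun x => U k x - u x) 1 (volume.restrict Ω)) atTop (𝓝 0) ∧
    Tendsto (fun k => eLpNorm (fun x => Laplacian.laplacian (U k) x - f x) (ENNReal.ofReal p)
      (powMeasure Ω (-s))) atTop (𝓝 0)

/-- The infimum `Λ(s, b)` of `∫_Ω |x|^{-s} |Δu|^p dx / ∫_Ω |x|^b |u|^p dx` over the nonzero `u` in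
`W^{2,p}_N(Ω, |x|^{-s} dx)`, with values in `[0, ∞]`. The numerator is finite and the denominator is
nonzero; if the denominator is infinite then the quotient is `0`. -/
noncomputable def rayleighInf {n : ℕ} (Ω : Set (EuclideanSpace ℝ (Fin n))) (p s b : ℝ) : ℝ≥0∞ :=
  ⨅ (u : EuclideanSpace ℝ (Fin n) → ℝ) (f : EuclideanSpace ℝ (Fin n) → ℝ)
    (_ : MemNavier Ω p s u f) (_ : ¬ u =ᵐ[volume.restrict Ω] 0),
    (∫⁻ x in Ω, ENNReal.ofReal (‖x‖ ^ (-s) * |f x| ^ p)) /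
      (∫⁻ x in Ω, ENNReal.ofReal (‖x‖ ^ b * |u x| ^ p))

/-! The inequality follows from a pointwise bound of `u` by a Riesz potential of `|Δu|` and a
Stein–Weiss inequality for that potential. Pointwise bound: for `0 < γ` and `γ ≥ n - 2`, the kernel
`|x - y|^{-γ}` dominates a nonnegative fundamental solution of `-Δ` on a bounded set, up to a
constant. If `u` vanishes on `∂Ω`, the maximum principle compares `±u` with the potential of `|Δu|`,
giving `|u| ≤ C ∫_Ω |x - y|^{-γ} |Δu(y)| dy` in `Ω` (`exists_ofReal_abs_le_laplacianPotential`). To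
stay with smooth kernels, the fundamental solution is regularized at scale `ε` and `|Δu|` is cut
off; the errors tend to zero while `C` depends only on `Ω` and `γ`. Weighted bound: for `0 < γ < n`
and the scaling-critical relation `b + s = p(γ - n)`, a Schur test with power weights bounds this
potential from `L^p(|x|^{-s})` to `L^p(|x|^b)` (`exists_lintegral_riesz_rpow_le`). The conditions `b
> -n` and `s > n - np` are what leaves room for the test exponent. On a bounded set `b` and `s` may
be decreased at the price of a constant. The assumption `s + b + 2p ≥ 0` allows them to be moved to
a critical pair with an admissible `γ ≥ n - 2` (`exists_critical_exponents`). The resulting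
inequality on `C²_N` passes to the completion by Fatou's lemma. -/

/-- The weight `‖x‖ ^ a` with values in `ℝ≥0∞`. -/
noncomputable def powWeight {n : ℕ} (a : ℝ) (x : EuclideanSpace ℝ (Fin n)) : ℝ≥0∞ :=
  ENNReal.ofReal (‖x‖ ^ a)

/-! ### Power weights and the composition of Riesz kernels -/

section Weights

variable {n : ℕ}

@[fun_prop]
lemma measurable_powWeight (a : ℝ) :
    Measurable (powWeight a : EuclideanSpace ℝ (Fin n) → ℝ≥0∞) := by
  unfold powWeight; fun_prop

lemma powWeight_pos (a : ℝ) {x : EuclideanSpace ℝ (Fin n)} (hx : x ≠ 0) : 0 < powWeight a x :=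
  ENNReal.ofReal_pos.2 (Real.rpow_pos_of_pos (norm_pos_iff.2 hx) a)

lemma powWeight_add (a b : ℝ) {x : EuclideanSpace ℝ (Fin n)} (hx : x ≠ 0) :
    powWeight (a + b) x = powWeight a x * powWeight b x := by
  unfold powWeight
  rw [Real.rpow_add (norm_pos_iff.2 hx), ENNReal.ofReal_mul (by positivity)]

lemma powWeight_rpow (a : ℝ) {t : ℝ} (ht : 0 ≤ t) (x : EuclideanSpace ℝ (Fin n)) :
    powWeight a x ^ t = powWeight (a * t) x := by
  unfold powWeight
  rw [ENNReal.ofReal_rpow_of_nonneg (by positivity) ht, Real.rpow_mul (norm_nonneg _)]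

lemma powWeight_smul (a : ℝ) {r : ℝ} (hr : 0 ≤ r) (x : EuclideanSpace ℝ (Fin n)) :
    powWeight a (r • x) = ENNReal.ofReal (r ^ a) * powWeight a x := by
  unfold powWeight
  rw [norm_smul, Real.norm_of_nonneg hr, Real.mul_rpow hr (norm_nonneg _),
    ENNReal.ofReal_mul (by positivity)]

lemma ae_ne_zero (hn : 1 ≤ n) : ∀ᵐ x : EuclideanSpace ℝ (Fin n), x ≠ 0 := by
  have : NeZero n := ⟨by omega⟩
  exact Measure.ae_ne volume 0

lemma lintegral_ball_powWeight_ne_top (hn : 1 ≤ n) {a : ℝ} (ha : a < n) (r : ℝ) :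
    ∫⁻ y in Metric.ball (0 : EuclideanSpace ℝ (Fin n)) r, powWeight (-a) y ≠ ⊤ := by
  have : NeZero n := ⟨by omega⟩
  rcases le_or_gt r 0 with hr | hr
  · simp [Metric.ball_eq_empty.2 hr]
  have h : IntegrableOn (fun y : EuclideanSpace ℝ (Fin n) => ‖y‖ ^ (-a)) (Metric.ball 0 r) := by
    rw [integrableOn_fun_norm_addHaar volume (f := fun t => t ^ (-a))]
    have h1 : IntegrableOn (fun t : ℝ => t ^ ((n : ℝ) - 1 - a)) (Set.Ioo 0 r) := by
      rw [intervalIntegral.integrableOn_Ioo_rpow_iff hr]; linarith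
    refine h1.congr_fun (fun t ht => ?_) measurableSet_Ioo
    simp only [finrank_euclideanSpace, Fintype.card_fin, smul_eq_mul]
    rw [← Real.rpow_natCast, ← Real.rpow_add ht.1, Nat.cast_sub hn]
    congr 1
    simp; ring
  exact h.lintegral_lt_top.ne

lemma lintegral_compl_ball_powWeight_ne_top (hn : 1 ≤ n) {a : ℝ} (ha : n < a) {r : ℝ}
    (hr : 0 < r) :
    ∫⁻ y in (Metric.ball (0 : EuclideanSpace ℝ (Fin n)) r)ᶜ, powWeight (-a) y ≠ ⊤ := by
  have : NeZero n := ⟨by omega⟩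
  have h : IntegrableOn (fun y : EuclideanSpace ℝ (Fin n) => ‖y‖ ^ (-a))
      (Metric.ball 0 r)ᶜ := by
    rw [← integrable_indicator_iff Metric.isOpen_ball.measurableSet.compl]
    have h2 : (Metric.ball (0 : EuclideanSpace ℝ (Fin n)) r)ᶜ.indicator (fun y => ‖y‖ ^ (-a))
        = fun y => (Set.Ici r).indicator (fun t : ℝ => t ^ (-a)) ‖y‖ := by
      ext y
      by_cases hy : r ≤ ‖y‖ <;> simp [Set.indicator, hy, not_le.1, not_lt]
    rw [h2, integrable_fun_norm_addHaar volume (f := (Set.Ici r).indicator fun t : ℝ => t ^ (-a))]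
    have h1 : IntegrableOn (fun t : ℝ => t ^ ((n : ℝ) - 1 - a)) (Set.Ici r) := by
      rw [integrableOn_Ici_iff_integrableOn_Ioi]
      exact integrableOn_Ioi_rpow_of_lt (by linarith) hr
    have h3 : IntegrableOn ((Set.Ici r).indicator fun t : ℝ => t ^ ((n : ℝ) - 1 - a))
        (Set.Ioi 0) := by
      exact ((integrable_indicator_iff measurableSet_Ici).2 h1).integrableOn
    refine h3.congr_fun (fun t ht => ?_) measurableSet_Ioi
    have ht : 0 < t := ht
    by_cases htr : t ∈ Set.Ici r
    · simp only [finrank_euclideanSpace, Fintype.card_fin, smul_eq_mul, Set.indicator_of_mem htr]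
      rw [← Real.rpow_natCast, ← Real.rpow_add ht, Nat.cast_sub hn]
      congr 1
      simp; ring
    · simp [Set.indicator_of_notMem htr]
  exact h.lintegral_lt_top.ne

lemma lintegral_smul_eq {r : ℝ} (hr : 0 < r) {f : EuclideanSpace ℝ (Fin n) → ℝ≥0∞} :
    ∫⁻ y, f y = ENNReal.ofReal (r ^ n) * ∫⁻ y, f (r • y) := by
  have h := Measure.map_addHaar_smul (volume : Measure (EuclideanSpace ℝ (Fin n))) hr.ne'
  have e := (Homeomorph.smulOfNeZero r hr.ne' :
    EuclideanSpace ℝ (Fin n) ≃ₜ _).measurableEmbedding.lintegral_map (μ := volume) f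
  simp only [Homeomorph.smulOfNeZero_apply] at e
  change ∫⁻ y, f y ∂(Measure.map (fun x => r • x) volume) = _ at e
  change Measure.map (fun x => r • x) volume = _ at h
  rw [h, lintegral_smul_measure] at e
  rw [← e, smul_eq_mul, ← mul_assoc, finrank_euclideanSpace, Fintype.card_fin,
    ← ENNReal.ofReal_mul (by positivity), abs_of_pos (by positivity),
    mul_inv_cancel₀ (by positivity)]
  simp

lemma powWeight_le_of_le {a r : ℝ} (ha : 0 ≤ a) (hr : 0 < r) {x : EuclideanSpace ℝ (Fin n)}
    (hx : r ≤ ‖x‖) : powWeight (-a) x ≤ ENNReal.ofReal (r ^ (-a)) :=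
  ENNReal.ofReal_le_ofReal (Real.rpow_le_rpow_of_nonpos hr hx (by linarith))

/-- Splits space into the part near `0`, the part near `x`, and the rest; in each part the
nonsingular factors are replaced by constants or by decay at infinity. -/
lemma powWeight_mul_le {a γ : ℝ} (ha : 0 ≤ a) (hγ : 0 ≤ γ) {x : EuclideanSpace ℝ (Fin n)}
    (hx : ‖x‖ = 1) (y : EuclideanSpace ℝ (Fin n)) :
    powWeight (-γ) (x - y) * powWeight (-a) y ≤
      ENNReal.ofReal ((1 / 2) ^ (-γ)) * (Metric.ball 0 (1 / 2)).indicator (powWeight (-a)) y +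
      ENNReal.ofReal ((1 / 2) ^ (-a)) *
        (Metric.ball 0 (1 / 2)).indicator (powWeight (-γ)) (x - y) +
      ENNReal.ofReal ((1 / 3) ^ (-γ)) *
        (Metric.ball 0 (1 / 2))ᶜ.indicator (powWeight (-(γ + a))) y := by
  have htri : 1 ≤ ‖x - y‖ + ‖y‖ := by rw [← hx]; simpa using norm_add_le (x - y) y
  have htri' : ‖y‖ ≤ ‖x - y‖ + 1 := by
    rw [← hx, ← norm_neg (x - y)]; simpa using norm_add_le (-(x - y)) x
  by_cases h1 : ‖y‖ < 1 / 2
  · have hm : y ∈ Metric.ball (0 : EuclideanSpace ℝ (Fin n)) (1 / 2) := by simpa using h1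
    rw [Set.indicator_of_mem hm, add_assoc]
    refine le_add_right (mul_le_mul_left ?_ _)
    exact powWeight_le_of_le hγ (by norm_num) (by linarith)
  have hm : y ∈ (Metric.ball (0 : EuclideanSpace ℝ (Fin n)) (1 / 2))ᶜ := by simpa using h1
  by_cases h2 : ‖x - y‖ < 1 / 2
  · have hm2 : x - y ∈ Metric.ball (0 : EuclideanSpace ℝ (Fin n)) (1 / 2) := by simpa using h2
    rw [Set.indicator_of_mem hm2, mul_comm (powWeight _ _)]
    refine le_add_right (le_add_left (mul_le_mul_left ?_ _))
    exact powWeight_le_of_le ha (by norm_num) (by linarith)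
  · rw [Set.indicator_of_mem hm]
    have hy0 : y ≠ 0 := by rintro rfl; norm_num at h1
    refine le_add_left ?_
    -- Away from `0` and `x`, `‖y‖ ≤ ‖x - y‖ + 1 ≤ 3‖x - y‖` since `‖x - y‖ ≥ 1/2`; hence the factor
    -- `1/3`.
    rw [neg_add, powWeight_add _ _ hy0, ← mul_assoc, ← powWeight_smul _ (by norm_num)]
    refine mul_le_mul_left ?_ _
    refine ENNReal.ofReal_le_ofReal (Real.rpow_le_rpow_of_nonpos ?_ ?_ (by linarith))
    · rw [norm_smul]; norm_num; exact hy0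
    · rw [norm_smul]; norm_num; linarith

/-- The Riesz composition bound. -/
lemma exists_lintegral_powWeight_mul_le (hn : 1 ≤ n) {a γ : ℝ} (ha : 0 < a) (han : a < n)
    (hγ : 0 < γ) (hγn : γ < n) (hsum : n < γ + a) :
    ∃ C : ℝ≥0∞, C ≠ ⊤ ∧ ∀ x : EuclideanSpace ℝ (Fin n), x ≠ 0 →
      ∫⁻ y, powWeight (-γ) (x - y) * powWeight (-a) y ≤ C * powWeight (n - γ - a) x := by
  set C : ℝ≥0∞ :=
    ENNReal.ofReal ((1 / 2) ^ (-γ)) *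
      (∫⁻ y in Metric.ball (0 : EuclideanSpace ℝ (Fin n)) (1 / 2), powWeight (-a) y) +
    ENNReal.ofReal ((1 / 2) ^ (-a)) *
      (∫⁻ y in Metric.ball (0 : EuclideanSpace ℝ (Fin n)) (1 / 2), powWeight (-γ) y) +
    ENNReal.ofReal ((1 / 3) ^ (-γ)) *
      (∫⁻ y in (Metric.ball (0 : EuclideanSpace ℝ (Fin n)) (1 / 2))ᶜ, powWeight (-(γ + a)) y)
    with hC
  -- On the unit sphere the three integrals converge because `a < n` at `0`, `γ < n` at `x`, and `γ
  -- + a > n` at infinity. Dilation by `‖x‖` then reduces every `x ≠ 0` to this case.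
  have hunit : ∀ x : EuclideanSpace ℝ (Fin n), ‖x‖ = 1 →
      ∫⁻ y, powWeight (-γ) (x - y) * powWeight (-a) y ≤ C := by
    intro x hx
    have hmb : MeasurableSet (Metric.ball (0 : EuclideanSpace ℝ (Fin n)) (1 / 2)) :=
      Metric.isOpen_ball.measurableSet
    have m1 : Measurable ((Metric.ball (0 : EuclideanSpace ℝ (Fin n)) (1 / 2)).indicator
      (powWeight (-a))) := (measurable_powWeight _).indicator hmb
    have m2 : Measurable ((Metric.ball (0 : EuclideanSpace ℝ (Fin n)) (1 / 2)).indicator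
      (powWeight (-γ))) := (measurable_powWeight _).indicator hmb
    have m3 : Measurable ((Metric.ball (0 : EuclideanSpace ℝ (Fin n)) (1 / 2))ᶜ.indicator
      (powWeight (-(γ + a)))) := (measurable_powWeight _).indicator hmb.compl
    refine (lintegral_mono (powWeight_mul_le ha.le hγ.le hx)).trans ?_
    rw [lintegral_add_left (by fun_prop), lintegral_add_left (by fun_prop),
      lintegral_const_mul _ (by fun_prop), lintegral_const_mul _ (by fun_prop),
      lintegral_const_mul _ (by fun_prop), lintegral_sub_left_eq_self
        (μ := (volume : Measure (EuclideanSpace ℝ (Fin n))))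
        ((Metric.ball (0 : EuclideanSpace ℝ (Fin n)) (1 / 2)).indicator (powWeight (-γ))) x,
      lintegral_indicator hmb, lintegral_indicator hmb, lintegral_indicator hmb.compl]
  refine ⟨C, ?_, fun x hx => ?_⟩
  · refine ENNReal.add_ne_top.2 ⟨ENNReal.add_ne_top.2 ⟨?_, ?_⟩, ?_⟩ <;>
      refine ENNReal.mul_ne_top ENNReal.ofReal_ne_top ?_
    · exact lintegral_ball_powWeight_ne_top hn han _
    · exact lintegral_ball_powWeight_ne_top hn hγn _
    · exact lintegral_compl_ball_powWeight_ne_top hn hsum (by norm_num)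
  · have hr : 0 < ‖x‖ := norm_pos_iff.2 hx
    have hx' : x = ‖x‖ • (‖x‖⁻¹ • x) := by rw [smul_smul, mul_inv_cancel₀ hr.ne', one_smul]
    have hu : ‖‖x‖⁻¹ • x‖ = 1 := by rw [norm_smul]; simp [hr.ne']
    rw [lintegral_smul_eq hr]
    have key : ∀ y, powWeight (-γ) (x - ‖x‖ • y) * powWeight (-a) (‖x‖ • y) =
        ENNReal.ofReal (‖x‖ ^ (-γ) * ‖x‖ ^ (-a)) *
          (powWeight (-γ) (‖x‖⁻¹ • x - y) * powWeight (-a) y) := by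
      intro y
      conv_lhs => rw [show x - ‖x‖ • y = ‖x‖ • (‖x‖⁻¹ • x - y) by rw [smul_sub, ← hx']]
      rw [powWeight_smul _ hr.le, powWeight_smul _ hr.le, ENNReal.ofReal_mul (by positivity)]
      ring
    simp_rw [key]
    rw [lintegral_const_mul _ (by fun_prop), ← mul_assoc, mul_comm, ← ENNReal.ofReal_mul
      (by positivity)]
    refine mul_le_mul' (hunit _ hu) (le_of_eq ?_)
    unfold powWeight
    rw [← Real.rpow_add hr, ← Real.rpow_natCast, ← Real.rpow_add hr]
    ring_nf

end Weights

/-! ### Schur test and the Stein–Weiss inequality -/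

section Schur

variable {n : ℕ}

/-- Hölder applied to the factors `|x-y|^{-γ/q} |y|^{-a/q}` and `|x-y|^{-γ/p} |y|^{a/q} g`, with `q`
conjugate to `p`, so that `p/q = p - 1`. -/
lemma rpow_lintegral_mul_le (hn : 1 ≤ n) {p a γ : ℝ} (hp : 1 < p)
    {g : EuclideanSpace ℝ (Fin n) → ℝ≥0∞} (hg : Measurable g) (x : EuclideanSpace ℝ (Fin n)) :
    (∫⁻ y, powWeight (-γ) (x - y) * g y) ^ p ≤
      (∫⁻ y, powWeight (-γ) (x - y) * powWeight (-a) y) ^ (p - 1) *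
        ∫⁻ y, powWeight (-γ) (x - y) * (powWeight (a * (p - 1)) y * g y ^ p) := by
  have : NeZero n := ⟨by omega⟩
  have hp0 : 0 < p := by linarith
  set q := p.conjExponent with hq
  have hpq : p.HolderConjugate q := Real.HolderConjugate.conjExponent hp
  have hq0 : 0 < q := hpq.symm.pos
  have hqp : q⁻¹ = (p - 1) / p := by rw [hq, Real.conjExponent, inv_div]
  have hsum : q⁻¹ + p⁻¹ = 1 := by rw [hqp]; field_simp; ring
  have hF : Measurable fun y => powWeight (-γ * q⁻¹) (x - y) * powWeight (-a * q⁻¹) y := by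
    fun_prop
  have hG : Measurable fun y => powWeight (-γ * p⁻¹) (x - y) * (powWeight (a * q⁻¹) y * g y) := by
    fun_prop
  have h := ENNReal.lintegral_mul_le_Lp_mul_Lq volume hpq.symm hF.aemeasurable hG.aemeasurable
  have e : ∫⁻ y, powWeight (-γ) (x - y) * g y =
      ∫⁻ y, powWeight (-γ * q⁻¹) (x - y) * powWeight (-a * q⁻¹) y *
        (powWeight (-γ * p⁻¹) (x - y) * (powWeight (a * q⁻¹) y * g y)) := by
    refine lintegral_congr_ae ?_
    filter_upwards [ae_ne_zero hn, Measure.ae_ne volume x] with y hy hyx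
    have hxy : x - y ≠ 0 := sub_ne_zero.2 hyx.symm
    have h1 : powWeight (-γ) (x - y) =
        powWeight (-γ * q⁻¹) (x - y) * powWeight (-γ * p⁻¹) (x - y) := by
      rw [← powWeight_add _ _ hxy, ← mul_add, hsum, mul_one]
    have h2 : powWeight (-a * q⁻¹) y * powWeight (a * q⁻¹) y = 1 := by
      rw [← powWeight_add _ _ hy]; simp [powWeight]
    rw [h1]
    calc _ = powWeight (-γ * q⁻¹) (x - y) * powWeight (-γ * p⁻¹) (x - y) * 1 * g y := by
          rw [mul_one]
      _ = _ := by rw [← h2]; ring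
  have eF : ∀ y, (powWeight (-γ * q⁻¹) (x - y) * powWeight (-a * q⁻¹) y) ^ q =
      powWeight (-γ) (x - y) * powWeight (-a) y := by
    intro y
    rw [ENNReal.mul_rpow_of_nonneg _ _ hq0.le, powWeight_rpow _ hq0.le, powWeight_rpow _ hq0.le]
    congr 2 <;> field_simp
  have eG : ∀ y, (powWeight (-γ * p⁻¹) (x - y) * (powWeight (a * q⁻¹) y * g y)) ^ p =
      powWeight (-γ) (x - y) * (powWeight (a * (p - 1)) y * g y ^ p) := by
    intro y
    rw [ENNReal.mul_rpow_of_nonneg _ _ hp0.le, ENNReal.mul_rpow_of_nonneg _ _ hp0.le,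
      powWeight_rpow _ hp0.le, powWeight_rpow _ hp0.le, hqp]
    congr 2
    · field_simp
    · congr 1; field_simp
  simp only [Pi.mul_apply] at h
  rw [← e] at h
  simp_rw [eF, eG] at h
  refine (ENNReal.rpow_le_rpow h hp0.le).trans (le_of_eq ?_)
  rw [ENNReal.mul_rpow_of_nonneg _ _ hp0.le, ← ENNReal.rpow_mul, ← ENNReal.rpow_mul, one_div,
    one_div, inv_mul_cancel₀ hp0.ne', ENNReal.rpow_one, hqp, div_mul_cancel₀ _ hp0.ne']

/-- The weighted `L^p` bound (Stein-Weiss) for the Riesz potential with scaling-critical weights. -/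
lemma exists_lintegral_riesz_rpow_le (hn : 1 ≤ n) {p s b γ : ℝ} (hp : 1 < p) (hγ : 0 < γ)
    (hγn : γ < n) (hb : -(n : ℝ) < b) (hs : (n : ℝ) - n * p < s) (hbs : b + s = p * (γ - n)) :
    ∃ C : ℝ≥0∞, C ≠ ⊤ ∧ ∀ g : EuclideanSpace ℝ (Fin n) → ℝ≥0∞, Measurable g →
      ∫⁻ x, powWeight b x * (∫⁻ y, powWeight (-γ) (x - y) * g y) ^ p ≤
        C * ∫⁻ y, powWeight (-s) y * g y ^ p := by
  have : NeZero n := ⟨by omega⟩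
  have hp1 : 0 < p - 1 := by linarith
  -- The test exponent is `a = e + n - γ`, and `a' = e(p-1) - b` appears after exchanging the
  -- integrals. The bounds on `e` make both lie strictly between `n - γ` and `n`, as the composition
  -- bound requires. The interval is nonempty: in view of `b + s = p(γ - n)`, the inequality `(n - γ
  -- + b)/(p - 1) < γ` is equivalent to `s > n - np`, and `b > -n` makes the other upper bound
  -- positive.
  obtain ⟨e, he1, he2⟩ : ∃ e, max 0 ((n - γ + b) / (p - 1)) < e ∧ e < min γ ((n + b) / (p - 1)) := by
    refine exists_between (max_lt (lt_min hγ (by apply div_pos <;> linarith)) (lt_min ?_ ?_))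
    · rw [div_lt_iff₀ hp1]; nlinarith
    · gcongr; linarith
  obtain ⟨he0, he3⟩ := max_lt_iff.1 he1
  obtain ⟨he4, he5⟩ := lt_min_iff.1 he2
  rw [div_lt_iff₀ hp1] at he3
  rw [lt_div_iff₀ hp1] at he5
  set a : ℝ := e + n - γ with ha
  set a' : ℝ := e * (p - 1) - b with ha'
  obtain ⟨C₁, hC₁, h₁⟩ := exists_lintegral_powWeight_mul_le hn (a := a) (by linarith)
    (by linarith) hγ hγn (by linarith)
  obtain ⟨C₂, hC₂, h₂⟩ := exists_lintegral_powWeight_mul_le hn (a := a') (by linarith)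
    (by linarith) hγ hγn (by linarith)
  refine ⟨C₁ ^ (p - 1) * C₂, ENNReal.mul_ne_top (ENNReal.rpow_ne_top_of_nonneg hp1.le hC₁) hC₂,
    fun g hg => ?_⟩
  calc ∫⁻ x, powWeight b x * (∫⁻ y, powWeight (-γ) (x - y) * g y) ^ p
      ≤ ∫⁻ x, ∫⁻ y, C₁ ^ (p - 1) * (powWeight (-a') x *
          (powWeight (-γ) (x - y) * (powWeight (a * (p - 1)) y * g y ^ p))) := by
        refine lintegral_mono_ae ?_
        filter_upwards [ae_ne_zero hn] with x hx
        rw [lintegral_const_mul _ (by fun_prop), lintegral_const_mul _ (by fun_prop), ← mul_assoc]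
        refine (mul_le_mul_right (rpow_lintegral_mul_le hn (a := a) hp hg x) _).trans ?_
        rw [← mul_assoc]
        refine mul_le_mul_left ?_ _
        refine (mul_le_mul_right (ENNReal.rpow_le_rpow (h₁ x hx) hp1.le) _).trans (le_of_eq ?_)
        rw [ENNReal.mul_rpow_of_nonneg _ _ hp1.le, powWeight_rpow _ hp1.le,
          show -a' = b + (n - γ - a) * (p - 1) by rw [ha, ha']; ring, powWeight_add _ _ hx]
        ring
    _ = ∫⁻ y, ∫⁻ x, C₁ ^ (p - 1) * (powWeight (-a') x *
          (powWeight (-γ) (x - y) * (powWeight (a * (p - 1)) y * g y ^ p))) := by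
        refine lintegral_lintegral_swap (Measurable.aemeasurable ?_)
        unfold Function.uncurry; fun_prop
    _ ≤ ∫⁻ y, C₁ ^ (p - 1) * C₂ * (powWeight (-s) y * g y ^ p) := by
        refine lintegral_mono_ae ?_
        filter_upwards [ae_ne_zero hn] with y hy
        have e1 : ∀ x, C₁ ^ (p - 1) * (powWeight (-a') x *
            (powWeight (-γ) (x - y) * (powWeight (a * (p - 1)) y * g y ^ p))) =
            C₁ ^ (p - 1) * (powWeight (a * (p - 1)) y * g y ^ p) *
              (powWeight (-γ) (y - x) * powWeight (-a') x) := by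
          intro x
          have : powWeight (-γ) (x - y) = powWeight (-γ) (y - x) := by
            simp only [powWeight, norm_sub_rev]
          rw [this]; ring
        simp_rw [e1]
        rw [lintegral_const_mul _ (by fun_prop)]
        -- The powers of `|y|` add up to `a(p-1) + n - γ - a' = p(n - γ) + b = -s`.
        refine (mul_le_mul_right (h₂ y hy) _).trans (le_of_eq ?_)
        rw [show -s = a * (p - 1) + (n - γ - a') by rw [ha, ha']; linarith, powWeight_add _ _ hy]
        ring
    _ = _ := lintegral_const_mul _ (by fun_prop)

end Schur

/-! ### Second derivatives along lines and the maximum principle -/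

/-- `F` has second derivative `c` at `x` along the line `t ↦ x + t • e`. -/
def HasLineDerivTwo {n : ℕ} (F : EuclideanSpace ℝ (Fin n) → ℝ) (x e : EuclideanSpace ℝ (Fin n))
    (c : ℝ) : Prop :=
  ∃ φ : ℝ → ℝ, (∀ᶠ t in 𝓝 (0 : ℝ), HasDerivAt (fun t : ℝ => F (x + t • e)) (φ t) t) ∧
    HasDerivAt φ c 0

section SecondDerivative

variable {n : ℕ}

/-- A positive second derivative would make the local maximum also a local minimum, hence `φ`
locally constant with zero second derivative. -/
lemma nonpos_of_isLocalMax_of_hasDerivAt {φ φ' : ℝ → ℝ} {c x : ℝ} (hmax : IsLocalMax φ x)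
    (h : ∀ᶠ t in 𝓝 x, HasDerivAt φ (φ' t) t) (h' : HasDerivAt φ' c x) : c ≤ 0 := by
  by_contra! hc
  have e : deriv φ =ᶠ[𝓝 x] φ' := h.mono fun t ht => ht.deriv
  have e2 : deriv (deriv φ) x = c := by rw [e.deriv_eq, h'.deriv]
  have hmin := isLocalMin_of_deriv_deriv_pos (by rw [e2]; exact hc) hmax.deriv_eq_zero
    h.self_of_nhds.continuousAt
  have e3 : φ =ᶠ[𝓝 x] fun _ => φ x := by
    filter_upwards [hmax, hmin] with t h1 h2 using le_antisymm h1 h2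
  have e4 : deriv (deriv φ) x = 0 := by
    have : deriv φ =ᶠ[𝓝 x] fun _ => 0 := by simpa using e3.deriv
    rw [this.deriv_eq]; simp
  linarith

lemma HasLineDerivTwo.add {F G : EuclideanSpace ℝ (Fin n) → ℝ} {x e : EuclideanSpace ℝ (Fin n)}
    {c d : ℝ} (hF : HasLineDerivTwo F x e c) (hG : HasLineDerivTwo G x e d) :
    HasLineDerivTwo (fun y => F y + G y) x e (c + d) := by
  obtain ⟨φ, h1, h2⟩ := hF
  obtain ⟨ψ, h3, h4⟩ := hG
  refine ⟨fun t => φ t + ψ t, ?_, h2.add h4⟩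
  filter_upwards [h1, h3] with t h5 h6 using h5.add h6

lemma HasLineDerivTwo.const_mul {F : EuclideanSpace ℝ (Fin n) → ℝ}
    {x e : EuclideanSpace ℝ (Fin n)} {c : ℝ} (a : ℝ) (hF : HasLineDerivTwo F x e c) :
    HasLineDerivTwo (fun y => a * F y) x e (a * c) := by
  obtain ⟨φ, h1, h2⟩ := hF
  exact ⟨fun t => a * φ t, h1.mono fun t h => h.const_mul a, h2.const_mul a⟩

lemma HasLineDerivTwo.nonpos {F : EuclideanSpace ℝ (Fin n) → ℝ}
    {x e : EuclideanSpace ℝ (Fin n)} {c : ℝ} (hF : HasLineDerivTwo F x e c)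
    (hmax : IsLocalMax F x) : c ≤ 0 := by
  obtain ⟨φ, h1, h2⟩ := hF
  refine nonpos_of_isLocalMax_of_hasDerivAt ?_ h1 h2
  have hc : Tendsto (fun t : ℝ => x + t • e) (𝓝 0) (𝓝 x) := by
    have : Continuous fun t : ℝ => x + t • e := by fun_prop
    simpa using this.tendsto 0
  have := hc.eventually hmax
  simpa [IsLocalMax, IsMaxFilter] using this

lemma ContDiffAt.hasLineDerivTwo {u : EuclideanSpace ℝ (Fin n) → ℝ}
    {x : EuclideanSpace ℝ (Fin n)} (hu : ContDiffAt ℝ 2 u x) (e : EuclideanSpace ℝ (Fin n)) :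
    HasLineDerivTwo u x e (iteratedFDeriv ℝ 2 u x ![e, e]) := by
  have hc : Continuous fun t : ℝ => x + t • e := by fun_prop
  have hl : ∀ t : ℝ, HasDerivAt (fun t : ℝ => x + t • e) e t := fun t => by
    simpa using ((hasDerivAt_id t).smul_const e).const_add x
  refine ⟨fun t => fderiv ℝ u (x + t • e) e, ?_, ?_⟩
  · have h0 : ∀ᶠ y in 𝓝 x, ContDiffAt ℝ 2 u y := hu.eventually (by simp)
    have h1 : ∀ᶠ y in 𝓝 x, DifferentiableAt ℝ u y := by
      filter_upwards [h0] with y hy using hy.differentiableAt two_ne_zero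
    have h2 : Tendsto (fun t : ℝ => x + t • e) (𝓝 0) (𝓝 x) := by simpa using hc.tendsto 0
    filter_upwards [h2.eventually h1] with t ht
    exact ht.hasFDerivAt.comp_hasDerivAt t (hl t)
  · have h3 : DifferentiableAt ℝ (fderiv ℝ u) (x + (0 : ℝ) • e) := by
      simpa using (hu.fderiv_right (m := 1) (by norm_num)).differentiableAt (by simp)
    have h5 : HasDerivAt (fun t : ℝ => fderiv ℝ u (x + t • e))
        (fderiv ℝ (fderiv ℝ u) (x + (0 : ℝ) • e) e) 0 :=
      h3.hasFDerivAt.comp_hasDerivAt (0 : ℝ) (hl 0)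
    have h4 := h5.clm_apply (hasDerivAt_const (0 : ℝ) e)
    rw [iteratedFDeriv_two_apply]
    simpa using h4

lemma hasLineDerivTwo_norm_sq (x e : EuclideanSpace ℝ (Fin n)) :
    HasLineDerivTwo (fun y => ‖y‖ ^ 2) x e (2 * ‖e‖ ^ 2) := by
  refine ⟨fun t => 2 * inner ℝ (x + t • e) e, Eventually.of_forall fun t => ?_, ?_⟩
  · have hl : HasDerivAt (fun t : ℝ => x + t • e) e t := by
      simpa using ((hasDerivAt_id t).smul_const e).const_add x
    exact hl.norm_sq
  · have : (fun t : ℝ => 2 * inner ℝ (x + t • e) e) =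
        fun t : ℝ => 2 * inner ℝ x e + t * (2 * ‖e‖ ^ 2) := by
      ext t
      rw [inner_add_left, inner_smul_left, real_inner_self_eq_norm_sq]
      simp; ring
    rw [this]
    simpa using ((hasDerivAt_id (0 : ℝ)).mul_const (2 * ‖e‖ ^ 2)).const_add (2 * inner ℝ x e)

/-- Maximum principle for `u - v + (δ/n)‖x‖²`. At an interior maximum with `u ≥ τ`, summing second
derivatives along the coordinate axes gives `Δu + |Δu| - δ + 2δ ≤ 0`, which contradicts `δ > 0`.
Line derivatives suffice, so `v` need not be known to be `C²`. -/
lemma le_of_subsolution (hn : 1 ≤ n) {Ω : Set (EuclideanSpace ℝ (Fin n))} (hΩ : IsOpen Ω) {R : ℝ}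
    (hR : Ω ⊆ Metric.closedBall 0 R) {u v : EuclideanSpace ℝ (Fin n) → ℝ}
    {A : EuclideanSpace ℝ (Fin n) → Fin n → ℝ} (hu : u ∈ C2N Ω) {τ δ : ℝ}
    (hτ : 0 < τ) (hδ : 0 < δ) (hv : Continuous v) (hv0 : ∀ x ∈ closure Ω, 0 ≤ v x)
    (hA : ∀ x i, HasLineDerivTwo v x (EuclideanSpace.basisFun (Fin n) ℝ i) (A x i))
    (hL : ∀ x ∈ Ω, τ ≤ u x → ∑ i, A x i ≤ δ - |Laplacian.laplacian u x|) :
    ∀ x ∈ Ω, u x ≤ τ + δ / n * R ^ 2 + v x := by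
  have hn' : (0 : ℝ) < n := by exact_mod_cast hn
  by_contra! hcon
  obtain ⟨x₁, hx₁, hlt⟩ := hcon
  have hRc : closure Ω ⊆ Metric.closedBall 0 R := closure_minimal hR Metric.isClosed_closedBall
  have hcpt : IsCompact (closure Ω) :=
    (isCompact_closedBall _ _).of_isClosed_subset isClosed_closure hRc
  have hZ : ContinuousOn (fun x => u x + (-1 * v x + δ / n * ‖x‖ ^ 2)) (closure Ω) :=
    hu.1.continuousOn.add (Continuous.continuousOn (by fun_prop))
  obtain ⟨x₀, hx₀, hmax⟩ := hcpt.exists_isMaxOn ⟨x₁, subset_closure hx₁⟩ hZ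
  have h01 := hmax (subset_closure hx₁)
  simp only [Set.mem_ofPred_eq] at h01
  have hnorm : δ / n * ‖x₀‖ ^ 2 ≤ δ / n * R ^ 2 := by
    have := hRc hx₀
    rw [mem_closedBall_zero_iff] at this
    gcongr
  have hpos : 0 ≤ δ / n * ‖x₁‖ ^ 2 := by positivity
  -- Since `v ≥ 0` and the quadratic term is at most `δ/n * R²`, a violation at `x₁` forces `u > τ`
  -- at the maximum point, which therefore is not on the boundary.
  have hux₀ : τ < u x₀ := by linarith [hv0 x₀ hx₀]
  have hx₀Ω : x₀ ∈ Ω := by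
    by_contra hx
    have : x₀ ∈ frontier Ω := by rw [frontier, hΩ.interior_eq]; exact ⟨hx₀, hx⟩
    linarith [hu.2 x₀ this]
  have hloc := hmax.isLocalMax (mem_of_superset (hΩ.mem_nhds hx₀Ω) subset_closure)
  have hC2 : ContDiffAt ℝ 2 u x₀ :=
    hu.1.contDiffAt (mem_of_superset (hΩ.mem_nhds hx₀Ω) subset_closure)
  have hi : ∀ i, iteratedFDeriv ℝ 2 u x₀ ![EuclideanSpace.basisFun (Fin n) ℝ i,
      EuclideanSpace.basisFun (Fin n) ℝ i] + (-1 * A x₀ i + δ / n * 2) ≤ 0 := by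
    intro i
    have := ((hC2.hasLineDerivTwo (EuclideanSpace.basisFun (Fin n) ℝ i)).add
      (((hA x₀ i).const_mul (-1)).add
        ((hasLineDerivTwo_norm_sq x₀ (EuclideanSpace.basisFun (Fin n) ℝ i)).const_mul
          (δ / n)))).nonpos hloc
    simpa using this
  have hsum := Finset.sum_nonpos fun i (_ : i ∈ Finset.univ) => hi i
  have hlap := congrFun (InnerProductSpace.laplacian_eq_iteratedFDeriv_orthonormalBasis u
    (EuclideanSpace.basisFun (Fin n) ℝ)) x₀
  rw [Finset.sum_add_distrib, ← hlap, Finset.sum_add_distrib, ← Finset.mul_sum,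
    Finset.sum_const, Finset.card_univ, Fintype.card_fin, nsmul_eq_mul] at hsum
  have h2 : (n : ℝ) * (δ / n * 2) = 2 * δ := by field_simp
  linarith [hL x₀ hx₀Ω hux₀.le, neg_abs_le (Laplacian.laplacian u x₀)]

end SecondDerivative

/-! ### The regularized fundamental solution -/

/-- The radial profile `∫_t^T τ^{-n/2} dτ`; at `t = ‖x‖²` it is, up to constants, the
fundamental solution of `-Δ` in dimension `n`. -/
noncomputable def radialProfile (n : ℕ) (T t : ℝ) : ℝ := ∫ τ in t..T, τ ^ (-(n : ℝ) / 2)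

/-- The regularized fundamental solution. -/
noncomputable def regKernel {n : ℕ} (T ε : ℝ) (x : EuclideanSpace ℝ (Fin n)) : ℝ :=
  radialProfile n T (‖x‖ ^ 2 + ε ^ 2)

/-- The first derivative of `regKernel` in direction `e`. -/
noncomputable def regKernelDeriv {n : ℕ} (ε : ℝ) (e x : EuclideanSpace ℝ (Fin n)) : ℝ :=
  -(2 * inner ℝ x e) * (‖x‖ ^ 2 + ε ^ 2) ^ (-(n : ℝ) / 2)

/-- The second derivative of `regKernel` in direction `e`. -/
noncomputable def regKernelDerivTwo {n : ℕ} (ε : ℝ) (e x : EuclideanSpace ℝ (Fin n)) : ℝ :=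
  -(2 * ‖e‖ ^ 2) * (‖x‖ ^ 2 + ε ^ 2) ^ (-(n : ℝ) / 2) +
    2 * n * inner ℝ x e ^ 2 * (‖x‖ ^ 2 + ε ^ 2) ^ (-(n : ℝ) / 2 - 1)

section Kernel

variable {n : ℕ}

lemma hasDerivAt_radialProfile {T t : ℝ} (hT : 0 < T) (ht : 0 < t) :
    HasDerivAt (radialProfile n T) (-t ^ (-(n : ℝ) / 2)) t := by
  have hpos : ∀ x ∈ Set.uIcc t T, x ≠ 0 := fun x hx => by
    rintro rfl
    exact absurd hx.1 (by simpa using And.intro ht hT)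
  have hcont : ContinuousOn (fun τ : ℝ => τ ^ (-(n : ℝ) / 2)) (Set.Ioi 0) := fun x hx =>
    (Real.continuousAt_rpow_const x _ (Or.inl (ne_of_gt hx))).continuousWithinAt
  refine intervalIntegral.integral_hasDerivAt_left ?_ ?_ ?_
  · exact ContinuousOn.intervalIntegrable fun x hx =>
      (Real.continuousAt_rpow_const x _ (Or.inl (hpos x hx))).continuousWithinAt
  · exact hcont.stronglyMeasurableAtFilter isOpen_Ioi t ht
  · exact Real.continuousAt_rpow_const t _ (Or.inl ht.ne')

lemma radialProfile_nonneg {T t : ℝ} (ht : 0 < t) (htT : t ≤ T) : 0 ≤ radialProfile n T t :=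
  intervalIntegral.integral_nonneg htT fun x hx => by
    have := ht.trans_le hx.1; positivity

/-- In `τ^{-n/2} = τ^{(γ-n)/2+1} τ^{-1-γ/2}` the first factor is nondecreasing because `γ ≥ n - 2`,
so it is at most its value at `T`; the second is integrated exactly. This treats all dimensions at
once, including the logarithmic case `n = 2`. -/
lemma radialProfile_le {T t γ : ℝ} (hγ : 0 < γ) (hγn : (n : ℝ) - 2 ≤ γ) (ht : 0 < t)
    (htT : t ≤ T) :
    radialProfile n T t ≤ T ^ ((γ - n) / 2 + 1) * (2 / γ) * t ^ (-γ / 2) := by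
  have hT : 0 < T := ht.trans_le htT
  have hcont : ∀ r : ℝ, IntervalIntegrable (fun τ : ℝ => τ ^ r) volume t T := fun r =>
    ContinuousOn.intervalIntegrable fun x hx => by
      rw [Set.uIcc_of_le htT] at hx
      exact (Real.continuousAt_rpow_const x _ (Or.inl (ht.trans_le hx.1).ne')).continuousWithinAt
  calc radialProfile n T t
      ≤ ∫ τ in t..T, T ^ ((γ - n) / 2 + 1) * τ ^ (-1 - γ / 2) := by
        refine intervalIntegral.integral_mono_on htT (hcont _) ((hcont _).const_mul _) ?_
        intro x hx
        have hx0 : 0 < x := ht.trans_le hx.1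
        calc x ^ (-(n : ℝ) / 2) = x ^ ((γ - n) / 2 + 1) * x ^ (-1 - γ / 2) := by
              rw [← Real.rpow_add hx0]; ring_nf
          _ ≤ _ := by
              refine mul_le_mul_of_nonneg_right ?_ (by positivity)
              exact Real.rpow_le_rpow hx0.le hx.2 (by linarith)
    _ = T ^ ((γ - n) / 2 + 1) * ((2 / γ) * (t ^ (-γ / 2) - T ^ (-γ / 2))) := by
        rw [intervalIntegral.integral_const_mul, integral_rpow]
        · rw [show -1 - γ / 2 + 1 = -γ / 2 by ring]
          congr 1
          field_simp
          ring
        · refine Or.inr ⟨by linarith, ?_⟩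
          rw [Set.uIcc_of_le htT]
          exact fun h => absurd h.1 (by simpa using ht)
    _ ≤ _ := by
        rw [mul_assoc]
        have : 0 ≤ T ^ (-γ / 2) := by positivity
        gcongr
        linarith

lemma norm_sq_add_pos {ε : ℝ} (hε : 0 < ε) (x : EuclideanSpace ℝ (Fin n)) :
    0 < ‖x‖ ^ 2 + ε ^ 2 := by positivity

lemma regKernel_nonneg {T ε : ℝ} (hε : 0 < ε) {x : EuclideanSpace ℝ (Fin n)}
    (hx : ‖x‖ ^ 2 + ε ^ 2 ≤ T) : 0 ≤ regKernel T ε x :=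
  radialProfile_nonneg (norm_sq_add_pos hε x) hx

lemma regKernel_le {T ε γ : ℝ} (hγ : 0 < γ) (hγn : (n : ℝ) - 2 ≤ γ) (hε : 0 < ε)
    {x : EuclideanSpace ℝ (Fin n)} (hx : ‖x‖ ^ 2 + ε ^ 2 ≤ T) (hx0 : x ≠ 0) :
    regKernel T ε x ≤ T ^ ((γ - n) / 2 + 1) * (2 / γ) * ‖x‖ ^ (-γ) := by
  have hT : 0 < T := (norm_sq_add_pos hε x).trans_le hx
  have hx1 : 0 < ‖x‖ := norm_pos_iff.2 hx0
  refine (radialProfile_le hγ hγn (norm_sq_add_pos hε x) hx).trans ?_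
  gcongr
  calc (‖x‖ ^ 2 + ε ^ 2) ^ (-γ / 2) ≤ (‖x‖ ^ 2) ^ (-γ / 2) :=
        Real.rpow_le_rpow_of_nonpos (by positivity) (by nlinarith) (by linarith)
    _ = ‖x‖ ^ (-γ) := by
        rw [← Real.rpow_natCast, ← Real.rpow_mul hx1.le]; congr 1; push_cast; ring

lemma hasDerivAt_norm_sq_line (x e : EuclideanSpace ℝ (Fin n)) (ε t : ℝ) :
    HasDerivAt (fun t : ℝ => ‖x + t • e‖ ^ 2 + ε ^ 2) (2 * inner ℝ (x + t • e) e) t := by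
  have hl : HasDerivAt (fun t : ℝ => x + t • e) e t := by
    simpa using ((hasDerivAt_id t).smul_const e).const_add x
  exact hl.norm_sq.add_const _

lemma hasDerivAt_regKernel {T ε : ℝ} (hT : 0 < T) (hε : 0 < ε)
    (x e : EuclideanSpace ℝ (Fin n)) (t : ℝ) :
    HasDerivAt (fun t : ℝ => regKernel T ε (x + t • e)) (regKernelDeriv ε e (x + t • e)) t := by
  have := (hasDerivAt_radialProfile (n := n) hT (norm_sq_add_pos hε (x + t • e))).comp t
    (hasDerivAt_norm_sq_line x e ε t)
  refine this.congr_deriv ?_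
  unfold regKernelDeriv; ring

lemma hasDerivAt_regKernelDeriv {ε : ℝ} (hε : 0 < ε) (x e : EuclideanSpace ℝ (Fin n)) (t : ℝ) :
    HasDerivAt (fun t : ℝ => regKernelDeriv ε e (x + t • e))
      (regKernelDerivTwo ε e (x + t • e)) t := by
  have h1 : HasDerivAt (fun t : ℝ => -(2 * inner ℝ (x + t • e) e)) (-(2 * ‖e‖ ^ 2)) t := by
    have : (fun t : ℝ => -(2 * inner ℝ (x + t • e) e)) =
        fun t : ℝ => -(2 * inner ℝ x e) + t * (-(2 * ‖e‖ ^ 2)) := by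
      ext t
      rw [inner_add_left, inner_smul_left, real_inner_self_eq_norm_sq]
      simp; ring
    rw [this]
    simpa using ((hasDerivAt_id t).mul_const (-(2 * ‖e‖ ^ 2))).const_add (-(2 * inner ℝ x e))
  have h2 := (hasDerivAt_norm_sq_line x e ε t).rpow_const (p := -(n : ℝ) / 2)
    (Or.inl (norm_sq_add_pos hε (x + t • e)).ne')
  refine (h1.mul h2).congr_deriv ?_
  unfold regKernelDerivTwo; ring

lemma continuous_regKernel {T ε : ℝ} (hT : 0 < T) (hε : 0 < ε) :
    Continuous (regKernel T ε : EuclideanSpace ℝ (Fin n) → ℝ) := by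
  refine continuous_iff_continuousAt.2 fun x => ?_
  exact ContinuousAt.comp (f := fun x : EuclideanSpace ℝ (Fin n) => ‖x‖ ^ 2 + ε ^ 2)
    (hasDerivAt_radialProfile hT (norm_sq_add_pos hε x)).continuousAt (by fun_prop)

lemma continuous_rpow_norm_sq {ε : ℝ} (hε : 0 < ε) (r : ℝ) :
    Continuous fun x : EuclideanSpace ℝ (Fin n) => (‖x‖ ^ 2 + ε ^ 2) ^ r :=
  Continuous.rpow_const (by fun_prop) fun x => Or.inl (norm_sq_add_pos hε x).ne'

lemma continuous_regKernelDeriv {ε : ℝ} (hε : 0 < ε) (e : EuclideanSpace ℝ (Fin n)) :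
    Continuous (regKernelDeriv ε e) := by
  have := continuous_rpow_norm_sq (n := n) hε (-(n : ℝ) / 2)
  unfold regKernelDeriv; fun_prop

lemma continuous_regKernelDerivTwo {ε : ℝ} (hε : 0 < ε) (e : EuclideanSpace ℝ (Fin n)) :
    Continuous (regKernelDerivTwo ε e) := by
  have := continuous_rpow_norm_sq (n := n) hε (-(n : ℝ) / 2)
  have := continuous_rpow_norm_sq (n := n) hε (-(n : ℝ) / 2 - 1)
  unfold regKernelDerivTwo; fun_prop

/-- The terms in `‖x‖²` cancel, and what remains is minus `ε^{-n}` times a fixed positive profile at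
`x/ε`: the regularized kernel is superharmonic and its `-Δ` is an approximate identity up to
normalization. -/
lemma sum_regKernelDerivTwo {ε : ℝ} (hε : 0 < ε) (x : EuclideanSpace ℝ (Fin n)) :
    ∑ i, regKernelDerivTwo ε (EuclideanSpace.basisFun (Fin n) ℝ i) x =
      -(2 * n * ε ^ 2 * (‖x‖ ^ 2 + ε ^ 2) ^ (-(n : ℝ) / 2 - 1)) := by
  have h := (EuclideanSpace.basisFun (Fin n) ℝ).sum_sq_inner_left x
  have hp := norm_sq_add_pos hε x
  have h2 : (‖x‖ ^ 2 + ε ^ 2) ^ (-(n : ℝ) / 2) =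
      (‖x‖ ^ 2 + ε ^ 2) * (‖x‖ ^ 2 + ε ^ 2) ^ (-(n : ℝ) / 2 - 1) := by
    rw [Real.rpow_sub_one hp.ne']; field_simp
  unfold regKernelDerivTwo
  rw [Finset.sum_add_distrib, ← Finset.sum_mul, ← Finset.sum_mul, ← Finset.mul_sum, h, h2]
  simp
  ring

end Kernel

/-! ### Potentials of continuous compactly supported densities -/

section Potential

variable {n : ℕ}

lemma integrable_mul_translate {F g : EuclideanSpace ℝ (Fin n) → ℝ} (hF : Continuous F)
    (hg : Continuous g) (hgc : HasCompactSupport g) (x : EuclideanSpace ℝ (Fin n)) :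
    Integrable fun y => F (x - y) * g y :=
  Continuous.integrable_of_hasCompactSupport (by fun_prop) hgc.mul_left

/-- All derivatives fall on the kernel, so `g` only has to be continuous. The dominating function
comes from the bound of `F'` on a compact set of arguments. -/
lemma hasDerivAt_integral_line {F F' g : EuclideanSpace ℝ (Fin n) → ℝ}
    {e : EuclideanSpace ℝ (Fin n)} (hF : Continuous F) (hF' : Continuous F')
    (hd : ∀ x t, HasDerivAt (fun t : ℝ => F (x + t • e)) (F' (x + t • e)) t)
    (hg : Continuous g) (hgc : HasCompactSupport g) (x : EuclideanSpace ℝ (Fin n)) (t : ℝ) :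
    HasDerivAt (fun t : ℝ => ∫ y, F (x + t • e - y) * g y)
      (∫ y, F' (x + t • e - y) * g y) t := by
  have hK : IsCompact ((fun q : ℝ × EuclideanSpace ℝ (Fin n) => F' (x + q.1 • e - q.2)) ''
      (Metric.closedBall t 1 ×ˢ tsupport g)) :=
    ((isCompact_closedBall _ _).prod hgc).image (by fun_prop)
  obtain ⟨M, hM⟩ := hK.isBounded.exists_norm_le
  refine (hasDerivAt_integral_of_dominated_loc_of_deriv_le (Metric.ball_mem_nhds t one_pos)
    (F := fun t y => F (x + t • e - y) * g y) (F' := fun t y => F' (x + t • e - y) * g y)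
    (bound := fun y => M * ‖g y‖) ?_ ?_ ?_ ?_ ?_ ?_).2
  · exact Eventually.of_forall fun r => (integrable_mul_translate hF hg hgc _).1
  · exact integrable_mul_translate hF hg hgc _
  · exact (integrable_mul_translate hF' hg hgc _).1
  · refine Eventually.of_forall fun y r hr => ?_
    rw [norm_mul]
    by_cases hy : y ∈ tsupport g
    · exact mul_le_mul_of_nonneg_right
        (hM _ ⟨(r, y), ⟨Metric.ball_subset_closedBall hr, hy⟩, rfl⟩) (norm_nonneg _)
    · simp [image_eq_zero_of_notMem_tsupport hy]
  · exact (hg.integrable_of_hasCompactSupport hgc).norm.const_mul M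
  · refine Eventually.of_forall fun y r _ => ?_
    have := (hd (x - y) r).mul_const (g y)
    simpa [sub_add_eq_add_sub] using this

lemma continuous_integral_translate {F g : EuclideanSpace ℝ (Fin n) → ℝ} (hF : Continuous F)
    (hg : Continuous g) (hgc : HasCompactSupport g) :
    Continuous fun x => ∫ y, F (x - y) * g y := by
  have h := continuous_parametric_integral_of_continuous (μ := volume)
    (f := fun x y : EuclideanSpace ℝ (Fin n) => F (x - y) * g y)
    (by unfold Function.uncurry; fun_prop) hgc
  convert h using 2 with x
  refine (setIntegral_eq_integral_of_forall_compl_eq_zero fun y hy => ?_).symm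
  simp [image_eq_zero_of_notMem_tsupport hy]

lemma hasLineDerivTwo_potential {T ε : ℝ} (hT : 0 < T) (hε : 0 < ε)
    {g : EuclideanSpace ℝ (Fin n) → ℝ} (hg : Continuous g) (hgc : HasCompactSupport g)
    (x e : EuclideanSpace ℝ (Fin n)) :
    HasLineDerivTwo (fun x => ∫ y, regKernel T ε (x - y) * g y) x e
      (∫ y, regKernelDerivTwo ε e (x - y) * g y) := by
  refine ⟨fun t => ∫ y, regKernelDeriv ε e (x + t • e - y) * g y,
    Eventually.of_forall fun t => ?_, ?_⟩
  · exact hasDerivAt_integral_line (continuous_regKernel hT hε) (continuous_regKernelDeriv hε e)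
      (fun x t => hasDerivAt_regKernel hT hε x e t) hg hgc x t
  · simpa using hasDerivAt_integral_line (continuous_regKernelDeriv hε e)
      (continuous_regKernelDerivTwo hε e) (fun x t => hasDerivAt_regKernelDeriv hε x e t)
      hg hgc x 0

/-- The mass of the approximate identity `-Δ (regKernel T ε)` near the origin. -/
noncomputable def kernelMass (n : ℕ) : ℝ :=
  2 * n * 2 ^ (-(n : ℝ) / 2 - 1) * volume.real (Metric.ball (0 : EuclideanSpace ℝ (Fin n)) 1)

lemma kernelMass_pos (hn : 1 ≤ n) : 0 < kernelMass n := by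
  have hn' : (0 : ℝ) < n := by exact_mod_cast hn
  have : 0 < volume.real (Metric.ball (0 : EuclideanSpace ℝ (Fin n)) 1) :=
    ENNReal.toReal_pos (Metric.measure_ball_pos _ _ one_pos).ne' measure_ball_lt_top.ne
  unfold kernelMass; positivity

/-- Only a lower bound for `-Δ` of the potential is needed: kernel and density are nonnegative, so
the integral may be restricted to the ball of radius `ε`, where `g ≥ g x - δ`. -/
lemma sum_integral_regKernelDerivTwo_le {ε δ : ℝ} (hε : 0 < ε)
    {g : EuclideanSpace ℝ (Fin n) → ℝ} (hg : Continuous g) (hgc : HasCompactSupport g)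
    (hg0 : ∀ x, 0 ≤ g x) {x : EuclideanSpace ℝ (Fin n)}
    (hx : ∀ y, dist y x < ε → g x - δ ≤ g y) :
    ∑ i, ∫ y, regKernelDerivTwo ε (EuclideanSpace.basisFun (Fin n) ℝ i) (x - y) * g y ≤
      -(kernelMass n * (g x - δ)) := by
  set η : EuclideanSpace ℝ (Fin n) → ℝ :=
    fun z => 2 * n * ε ^ 2 * (‖z‖ ^ 2 + ε ^ 2) ^ (-(n : ℝ) / 2 - 1) with hη
  have hηc : Continuous η := (continuous_rpow_norm_sq hε _).const_mul _
  have hη0 : ∀ z, 0 ≤ η z := fun z => by rw [hη]; positivity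
  have hint : Integrable fun y => η (x - y) * g y := integrable_mul_translate hηc hg hgc x
  rw [← integral_finsetSum _ fun i _ =>
    integrable_mul_translate (continuous_regKernelDerivTwo hε _) hg hgc x]
  simp_rw [← Finset.sum_mul, sum_regKernelDerivTwo hε, neg_mul]
  rw [integral_neg, neg_le_neg_iff]
  change _ ≤ ∫ y, η (x - y) * g y
  rcases le_or_gt (g x - δ) 0 with hgx | hgx
  · refine (mul_nonpos_of_nonneg_of_nonpos ?_ hgx).trans
      (integral_nonneg fun y => mul_nonneg (hη0 _) (hg0 _))
    unfold kernelMass; positivity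
  -- A lower bound of `η` on that ball, where `‖z‖² + ε² ≤ 2ε²`. Multiplied by the volume of the
  -- ball it is independent of `ε`.
  set m : ℝ := 2 * n * ε ^ 2 * (2 * ε ^ 2) ^ (-(n : ℝ) / 2 - 1) with hm
  have hfin : volume (Metric.ball x ε) ≠ ⊤ := measure_ball_lt_top.ne
  have hvol : volume.real (Metric.ball x ε) =
      ε ^ n * volume.real (Metric.ball (0 : EuclideanSpace ℝ (Fin n)) 1) := by
    rw [measureReal_def, Measure.addHaar_ball_of_pos _ _ hε, ENNReal.toReal_mul,
      ENNReal.toReal_ofReal (by positivity), finrank_euclideanSpace, Fintype.card_fin,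
      measureReal_def]
  have hmass : kernelMass n = m * volume.real (Metric.ball x ε) := by
    have h1 : (ε ^ 2) ^ (-(n : ℝ) / 2 - 1) = (ε ^ n)⁻¹ * (ε ^ 2)⁻¹ := by
      rw [← Real.rpow_natCast ε 2, ← Real.rpow_mul hε.le, ← Real.rpow_natCast ε n,
        ← Real.rpow_neg hε.le, ← Real.rpow_neg hε.le, ← Real.rpow_add hε]
      congr 1; push_cast; ring
    rw [hvol, hm, kernelMass, Real.mul_rpow (by norm_num) (by positivity), h1]
    field_simp
  calc kernelMass n * (g x - δ) = ∫ y in Metric.ball x ε, m * (g x - δ) := by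
        rw [setIntegral_const, smul_eq_mul, hmass]; ring
    _ ≤ ∫ y in Metric.ball x ε, η (x - y) * g y := by
        refine setIntegral_mono_on (integrableOn_const hfin) hint.integrableOn
          Metric.isOpen_ball.measurableSet fun y hy => ?_
        refine mul_le_mul ?_ (hx y hy) hgx.le (hη0 _)
        rw [hm, hη]
        refine mul_le_mul_of_nonneg_left ?_ (by positivity)
        have hxy : ‖x - y‖ < ε := by rw [← dist_eq_norm, dist_comm]; exact hy
        refine Real.rpow_le_rpow_of_nonpos (norm_sq_add_pos hε _) ?_ ?_
        · nlinarith [norm_nonneg (x - y)]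
        · have : (0 : ℝ) ≤ n := n.cast_nonneg
          linarith
    _ ≤ ∫ y, η (x - y) * g y :=
        setIntegral_le_integral hint (Eventually.of_forall fun y => mul_nonneg (hη0 _) (hg0 _))

end Potential

/-! ### Pointwise bound by the potential of the Laplacian -/

section PointwiseBound

variable {n : ℕ} {Ω : Set (EuclideanSpace ℝ (Fin n))}

lemma ContDiffAt.continuousAt_laplacian {u : EuclideanSpace ℝ (Fin n) → ℝ}
    {x : EuclideanSpace ℝ (Fin n)} (hu : ContDiffAt ℝ 2 u x) :
    ContinuousAt (Laplacian.laplacian u) x := by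
  rw [InnerProductSpace.laplacian_eq_iteratedFDeriv_orthonormalBasis u
    (EuclideanSpace.basisFun (Fin n) ℝ)]
  refine tendsto_finsetSum _ fun i _ => ?_
  have h3 : ContinuousAt (fderiv ℝ (fderiv ℝ u)) x :=
    ((hu.fderiv_right (m := 1) (by norm_num)).fderiv_right (m := 0) (by norm_num)).continuousAt
  have h4 : ContinuousAt (fun x => fderiv ℝ (fderiv ℝ u) x (EuclideanSpace.basisFun (Fin n) ℝ i)
      (EuclideanSpace.basisFun (Fin n) ℝ i)) x :=
    (h3.clm_apply continuousAt_const).clm_apply continuousAt_const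
  simp only [iteratedFDeriv_two_apply]
  exact h4

lemma continuousOn_laplacian (hΩ : IsOpen Ω) {u : EuclideanSpace ℝ (Fin n) → ℝ}
    (hu : u ∈ C2N Ω) : ContinuousOn (Laplacian.laplacian u) Ω := fun _ hx =>
  (hu.1.contDiffAt (mem_of_superset (hΩ.mem_nhds hx)
    subset_closure)).continuousAt_laplacian.continuousWithinAt

lemma neg_mem_C2N {u : EuclideanSpace ℝ (Fin n) → ℝ} (hu : u ∈ C2N Ω) : -u ∈ C2N Ω :=
  ⟨hu.1.neg, fun x hx => by simp [hu.2 x hx]⟩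

/-- As `u = 0` on the boundary, `{u ≥ τ}` is a compact subset of `Ω`; a cutoff equal to `1` there
turns `|Δu|` into a continuous compactly supported density, with no control of `Δu` at the boundary.
The maximum principle only uses the equation on this set. -/
lemma exists_cutoff_laplacian (hΩ : IsOpen Ω) (hb : Bornology.IsBounded Ω)
    {u : EuclideanSpace ℝ (Fin n) → ℝ} (hu : u ∈ C2N Ω) {τ : ℝ} (hτ : 0 < τ) :
    ∃ g : EuclideanSpace ℝ (Fin n) → ℝ, Continuous g ∧ HasCompactSupport g ∧ (∀ x, 0 ≤ g x) ∧
      (∀ x ∈ Ω, g x ≤ |Laplacian.laplacian u x|) ∧ (∀ x, x ∉ Ω → g x = 0) ∧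
      ∀ x ∈ Ω, τ ≤ u x → g x = |Laplacian.laplacian u x| := by
  set S := closure Ω ∩ u ⁻¹' Set.Ici τ
  have hS : IsClosed S := hu.1.continuousOn.preimage_isClosed_of_isClosed isClosed_closure
    isClosed_Ici
  have hSΩ : S ⊆ Ω := fun x hx => by
    by_contra h
    have : x ∈ frontier Ω := by rw [frontier, hΩ.interior_eq]; exact ⟨hx.1, h⟩
    have h2 : τ ≤ u x := hx.2
    linarith [hu.2 x this]
  obtain ⟨χ, hχ, h1, h01⟩ := exists_tsupport_one_of_isOpen_isClosed hΩ hb.isCompact_closure hS hSΩ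
  have hχ0 : ∀ x, x ∉ Ω → χ x = 0 := fun x hx =>
    image_eq_zero_of_notMem_tsupport fun h => hx (hχ h)
  have hts : tsupport (fun x => χ x * |Laplacian.laplacian u x|) ⊆ tsupport χ :=
    tsupport_mul_subset_left
  refine ⟨fun x => χ x * |Laplacian.laplacian u x|, ?_, ?_, ?_, ?_, ?_, ?_⟩
  · exact (χ.continuous.continuousOn.mul
      (continuousOn_laplacian hΩ hu).abs).continuous_of_tsupport_subset hΩ (hts.trans hχ)
  · exact hb.isCompact_closure.of_isClosed_subset (isClosed_tsupport _)
      (hts.trans (hχ.trans subset_closure))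
  · exact fun x => mul_nonneg (h01 x).1 (abs_nonneg _)
  · exact fun x _ => mul_le_of_le_one_left (abs_nonneg _) (h01 x).2
  · exact fun x hx => by simp [hχ0 x hx]
  · intro x hx hux
    have : χ x = 1 := h1 ⟨subset_closure hx, hux⟩
    simp [this]

/-- The Riesz potential of `|Δu| 1_Ω`. -/
noncomputable def laplacianPotential (Ω : Set (EuclideanSpace ℝ (Fin n))) (γ : ℝ)
    (u : EuclideanSpace ℝ (Fin n) → ℝ) (x : EuclideanSpace ℝ (Fin n)) : ℝ≥0∞ :=
  ∫⁻ y, powWeight (-γ) (x - y) *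
    Ω.indicator (fun y => ENNReal.ofReal |Laplacian.laplacian u y|) y

lemma exists_ofReal_le_laplacianPotential (hn : 1 ≤ n) (hΩ : IsOpen Ω)
    (hb : Bornology.IsBounded Ω) {γ : ℝ} (hγ : 0 < γ) (hγn : (n : ℝ) - 2 ≤ γ) :
    ∃ C : ℝ, ∀ u ∈ C2N Ω, ∀ x ∈ Ω,
      ENNReal.ofReal (u x) ≤ ENNReal.ofReal C * laplacianPotential Ω γ u x := by
  have : NeZero n := ⟨by omega⟩
  have hn' : (0 : ℝ) < n := by exact_mod_cast hn
  obtain ⟨R, hR0, hR⟩ := hb.subset_closedBall_lt 0 0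
  -- Large enough that `‖x - y‖² + ε² ≤ T` for `x ∈ closure Ω`, `y ∈ Ω` and `ε ≤ 1`, which keeps the
  -- kernel nonnegative.
  set T : ℝ := (2 * R) ^ 2 + 1 with hT
  have hT0 : 0 < T := by positivity
  set C : ℝ := T ^ ((γ - n) / 2 + 1) * (2 / γ) with hC
  have hC0 : 0 ≤ C := by positivity
  have hκ := kernelMass_pos hn
  set κ := kernelMass n
  refine ⟨κ⁻¹ * C, fun u hu x hx => ?_⟩
  refine ENNReal.le_of_forall_pos_le_add fun ε₀ hε₀ _ => ?_
  have hε₀' : (0 : ℝ) < ε₀ := hε₀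
  -- The two errors of the comparison, `τ` and `δ/n * R²`, are each `ε₀/2`; the constant `κ⁻¹ * C`
  -- does not depend on `ε₀` or `u`.
  set τ : ℝ := ε₀ / 2 with hτ
  set δ : ℝ := n * ε₀ / (2 * R ^ 2) with hδ
  have hτ0 : 0 < τ := by positivity
  have hδ0 : 0 < δ := by positivity
  have hsum : τ + δ / n * R ^ 2 = ε₀ := by rw [hτ, hδ]; field_simp; norm_num
  obtain ⟨g, hg, hgc, hg0, hgle, hgΩ, hgeq⟩ := exists_cutoff_laplacian hΩ hb hu hτ0
  obtain ⟨ε₁, hε₁, huc⟩ := Metric.uniformContinuous_iff.1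
    (hgc.uniformContinuous_of_continuous hg) δ hδ0
  set ε : ℝ := min ε₁ 1 with hε
  have hε0 : 0 < ε := lt_min hε₁ one_pos
  have hεT : ∀ x ∈ closure Ω, ∀ y ∈ Ω, ‖x - y‖ ^ 2 + ε ^ 2 ≤ T := by
    intro x hx y hy
    have h1 := closure_minimal hR Metric.isClosed_closedBall hx
    have h2 := hR hy
    rw [mem_closedBall_zero_iff] at h1 h2
    have h3 := norm_sub_le x y
    have h4 : ‖x - y‖ ^ 2 ≤ (2 * R) ^ 2 := by gcongr; linarith
    have h5 : ε ^ 2 ≤ 1 := pow_le_one₀ hε0.le (min_le_right _ _)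
    linarith
  have hKg : ∀ x ∈ closure Ω, ∀ y, 0 ≤ regKernel T ε (x - y) * g y := by
    intro x hx y
    by_cases hy : y ∈ Ω
    · exact mul_nonneg (regKernel_nonneg hε0 (hεT x hx y hy)) (hg0 y)
    · simp [hgΩ y hy]
  have key := le_of_subsolution hn hΩ hR hu hτ0 hδ0
    (v := fun x => κ⁻¹ * ∫ y, regKernel T ε (x - y) * g y)
    (A := fun x i => κ⁻¹ * ∫ y, regKernelDerivTwo ε (EuclideanSpace.basisFun (Fin n) ℝ i) (x - y)
      * g y)
    ((continuous_integral_translate (continuous_regKernel hT0 hε0) hg hgc).const_mul κ⁻¹)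
    (fun x hx => mul_nonneg (by positivity) (integral_nonneg (hKg x hx)))
    (fun x i => (hasLineDerivTwo_potential hT0 hε0 hg hgc x _).const_mul κ⁻¹)
    -- Uniform continuity of `g` at scale `ε` gives `Δv ≤ δ - g x`, and `g x = |Δu x|` where `u ≥
    -- τ`.
    (fun x hx hux => by
      have h1 := sum_integral_regKernelDerivTwo_le (δ := δ) hε0 hg hgc hg0 (x := x)
        (fun y hy => by
          have h := huc (hy.trans_le (min_le_left _ _))
          rw [Real.dist_eq] at h
          linarith [(abs_lt.1 h).1])
      rw [← Finset.mul_sum, ← hgeq x hx hux]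
      calc _ ≤ κ⁻¹ * -(κ * (g x - δ)) := by gcongr
        _ = _ := by field_simp; ring)
    x hx
  rw [hsum] at key
  refine (ENNReal.ofReal_le_ofReal key).trans ?_
  rw [add_comm, ENNReal.ofReal_add (mul_nonneg (by positivity)
    (integral_nonneg (hKg x (subset_closure hx)))) hε₀'.le, ENNReal.ofReal_coe_nnreal]
  gcongr
  rw [ENNReal.ofReal_mul (by positivity), ENNReal.ofReal_mul (by positivity), mul_assoc]
  gcongr
  rw [ofReal_integral_eq_lintegral_ofReal
    (integrable_mul_translate (continuous_regKernel hT0 hε0) hg hgc x)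
    (Eventually.of_forall (hKg x (subset_closure hx))), laplacianPotential,
    ← lintegral_const_mul' _ _ ENNReal.ofReal_ne_top]
  refine lintegral_mono_ae ?_
  filter_upwards [Measure.ae_ne volume x] with y hyx
  by_cases hy : y ∈ Ω
  · rw [Set.indicator_of_mem hy, powWeight, ← mul_assoc, ← ENNReal.ofReal_mul hC0,
      ← ENNReal.ofReal_mul (by positivity)]
    refine ENNReal.ofReal_le_ofReal (mul_le_mul ?_ (hgle y hy) (hg0 y) (by positivity))
    exact regKernel_le hγ hγn hε0 (hεT x (subset_closure hx) y hy) (sub_ne_zero.2 hyx.symm)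
  · simp [hgΩ y hy]

lemma laplacianPotential_neg (γ : ℝ) (u : EuclideanSpace ℝ (Fin n) → ℝ) :
    laplacianPotential Ω γ (-u) = laplacianPotential Ω γ u := by
  ext x
  simp [laplacianPotential, InnerProductSpace.laplacian_neg]

/-- Pointwise bound of a function vanishing on the boundary by the Riesz potential of its
Laplacian. -/
lemma exists_ofReal_abs_le_laplacianPotential (hn : 1 ≤ n) (hΩ : IsOpen Ω)
    (hb : Bornology.IsBounded Ω) {γ : ℝ} (hγ : 0 < γ) (hγn : (n : ℝ) - 2 ≤ γ) :
    ∃ C : ℝ, ∀ u ∈ C2N Ω, ∀ x ∈ Ω,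
      ENNReal.ofReal |u x| ≤ ENNReal.ofReal C * laplacianPotential Ω γ u x := by
  obtain ⟨C, hC⟩ := exists_ofReal_le_laplacianPotential hn hΩ hb hγ hγn
  refine ⟨C, fun u hu x hx => ?_⟩
  rcases abs_cases (u x) with h | h
  · rw [h.1]; exact hC u hu x hx
  · rw [h.1, ← laplacianPotential_neg]; exact hC (-u) (neg_mem_C2N hu) x hx

end PointwiseBound

/-! ### Reduction to critical exponents and passage to the completion -/

section Embedding

variable {n : ℕ} {Ω : Set (EuclideanSpace ℝ (Fin n))}

lemma powWeight_le_mul {a a' R : ℝ} (haa : a' ≤ a) {x : EuclideanSpace ℝ (Fin n)} (hx : x ≠ 0)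
    (hxR : ‖x‖ ≤ R) : powWeight a x ≤ ENNReal.ofReal (R ^ (a - a')) * powWeight a' x := by
  have h : a = (a - a') + a' := by ring
  conv_lhs => rw [h, powWeight_add _ _ hx]
  gcongr
  exact ENNReal.ofReal_le_ofReal (Real.rpow_le_rpow (norm_nonneg _) hxR (by linarith))

lemma exists_critical_exponents (hn : 1 ≤ n) {p s b : ℝ} (hp : 1 < p)
    (hs : (n : ℝ) - n * p < s) (hb : -(n : ℝ) < b) (hsb : 0 ≤ s + b + 2 * p) :
    ∃ γ s' b' : ℝ, 0 < γ ∧ γ < n ∧ (n : ℝ) - 2 ≤ γ ∧ (n : ℝ) - n * p < s' ∧ s' ≤ s ∧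
      -(n : ℝ) < b' ∧ b' ≤ b ∧ b' + s' = p * (γ - n) := by
  have hn' : (1 : ℝ) ≤ n := by exact_mod_cast hn
  have hp0 : 0 < p := by linarith
  -- The first entry is the critical `γ` for the given `b + s`, at least `n - 2` by the hypothesis
  -- on `s + b + 2p`; the second enforces `γ < n`.
  set γ : ℝ := min (n + (b + s) / p) (n - 1 / 2) with hγ
  have hγ0 : 0 < γ := by
    refine lt_min ?_ (by linarith)
    have : -(n : ℝ) < (b + s) / p := by rw [lt_div_iff₀ hp0]; nlinarith
    linarith
  have hγ1 : p * (γ - n) ≤ b + s := by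
    have h1 : γ - n ≤ (b + s) / p := by linarith [min_le_left (n + (b + s) / p) ((n : ℝ) - 1 / 2)]
    rw [le_div_iff₀ hp0] at h1
    linarith
  have hγ2 : (n : ℝ) - 2 ≤ γ := by
    refine le_min ?_ (by linarith)
    have : -2 ≤ (b + s) / p := by rw [le_div_iff₀ hp0]; linarith
    linarith
  have hA : 0 < b + n := by linarith
  have hB : 0 < s - n + n * p := by linarith
  have hD : 0 < p * γ := by positivity
  -- The distances of `b` to `-n` and of `s` to `n - np` are shrunk by the same factor `θ ≤ 1`. This
  -- keeps both strict inequalities, and `θ` is chosen so that the new exponents satisfy `b' + s' =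
  -- p(γ - n)`.
  set θ : ℝ := p * γ / ((b + n) + (s - n + n * p)) with hθ
  have hθ0 : 0 < θ := by positivity
  have hθ1 : θ ≤ 1 := by rw [hθ, div_le_one (by positivity)]; linarith
  have hθ2 : θ * ((b + n) + (s - n + n * p)) = p * γ := 
    div_mul_cancel₀ _ (by positivity)
  refine ⟨γ, n - n * p + θ * (s - n + n * p), -n + θ * (b + n), hγ0,
    (min_le_right _ _).trans_lt (by linarith), hγ2, ?_, ?_, ?_, ?_, ?_⟩
  · have := mul_pos hθ0 hB; linarith
  · have := mul_le_of_le_one_left hB.le hθ1; linarith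
  · have := mul_pos hθ0 hA; linarith
  · have := mul_le_of_le_one_left hA.le hθ1; linarith
  · linarith

/-- The weighted Rellich inequality on `C²_N(Ω̄)`. -/
lemma exists_lintegral_le_lintegral_laplacian (hn : 1 ≤ n) (hΩ : IsOpen Ω)
    (hb' : Bornology.IsBounded Ω) {p s b : ℝ} (hp : 1 < p)
    (hs : (n : ℝ) - n * p < s) (hb : -(n : ℝ) < b) (hsb : 0 ≤ s + b + 2 * p) :
    ∃ C : ℝ≥0∞, C ≠ ⊤ ∧ ∀ u ∈ C2N Ω,
      ∫⁻ x in Ω, powWeight b x * ENNReal.ofReal |u x| ^ p ≤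
        C * ∫⁻ x in Ω, powWeight (-s) x * ENNReal.ofReal |Laplacian.laplacian u x| ^ p := by
  have hp0 : 0 < p := by linarith
  obtain ⟨γ, s₁, b₁, hγ, hγn, hγ2, hs₁, hss, hb₁, hbb, hsum⟩ :=
    exists_critical_exponents hn hp hs hb hsb
  obtain ⟨R, hR0, hR⟩ := hb'.subset_closedBall_lt 0 0
  have hRn : ∀ x ∈ Ω, ‖x‖ ≤ R := fun x hx => by simpa using hR hx
  obtain ⟨C₁, h₁⟩ := exists_ofReal_abs_le_laplacianPotential hn hΩ hb' hγ hγ2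
  obtain ⟨C₂, hC₂, h₂⟩ := exists_lintegral_riesz_rpow_le hn hp hγ hγn hb₁ hs₁ hsum
  refine ⟨ENNReal.ofReal (R ^ (b - b₁)) * ENNReal.ofReal C₁ ^ p * C₂ *
    ENNReal.ofReal (R ^ (-s₁ - -s)), ?_, fun u hu => ?_⟩
  · refine ENNReal.mul_ne_top (ENNReal.mul_ne_top (ENNReal.mul_ne_top ENNReal.ofReal_ne_top
      (ENNReal.rpow_ne_top_of_nonneg hp0.le ENNReal.ofReal_ne_top)) hC₂) ENNReal.ofReal_ne_top
  set g : EuclideanSpace ℝ (Fin n) → ℝ≥0∞ :=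
    Ω.indicator fun y => ENNReal.ofReal |Laplacian.laplacian u y| with hg
  have hgm : Measurable g := by
    have h : ContinuousOn (fun y => ENNReal.ofReal |Laplacian.laplacian u y|) Ω :=
      ENNReal.continuous_ofReal.comp_continuousOn (continuousOn_laplacian hΩ hu).abs
    classical
    have := h.measurable_piecewise (g := fun _ => (0 : ℝ≥0∞)) continuousOn_const hΩ.measurableSet
    rwa [hg, ← Set.piecewise_eq_indicator]
  have hm : Measurable fun x : EuclideanSpace ℝ (Fin n) =>
      powWeight b₁ x * (∫⁻ y, powWeight (-γ) (x - y) * g y) ^ p := by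
    have : Measurable fun x : EuclideanSpace ℝ (Fin n) => ∫⁻ y, powWeight (-γ) (x - y) * g y :=
      Measurable.lintegral_prod_right' (f := fun q : EuclideanSpace ℝ (Fin n) ×
        EuclideanSpace ℝ (Fin n) => powWeight (-γ) (q.1 - q.2) * g q.2) (by fun_prop)
    fun_prop
  calc ∫⁻ x in Ω, powWeight b x * ENNReal.ofReal |u x| ^ p
      ≤ ∫⁻ x in Ω, ENNReal.ofReal (R ^ (b - b₁)) * ENNReal.ofReal C₁ ^ p *
          (powWeight b₁ x * (∫⁻ y, powWeight (-γ) (x - y) * g y) ^ p) := by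
        refine lintegral_mono_ae ?_
        filter_upwards [ae_restrict_mem hΩ.measurableSet, ae_restrict_of_ae (ae_ne_zero hn)]
          with x hx hx0
        refine (mul_le_mul' (powWeight_le_mul hbb hx0 (hRn x hx))
          (ENNReal.rpow_le_rpow (h₁ u hu x hx) hp0.le)).trans (le_of_eq ?_)
        rw [ENNReal.mul_rpow_of_nonneg _ _ hp0.le, laplacianPotential]
        ring
    _ ≤ ∫⁻ x, ENNReal.ofReal (R ^ (b - b₁)) * ENNReal.ofReal C₁ ^ p *
          (powWeight b₁ x * (∫⁻ y, powWeight (-γ) (x - y) * g y) ^ p) :=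
        setLIntegral_le_lintegral _ _
    _ ≤ ENNReal.ofReal (R ^ (b - b₁)) * ENNReal.ofReal C₁ ^ p *
          (C₂ * ∫⁻ y, powWeight (-s₁) y * g y ^ p) := by
        rw [lintegral_const_mul _ hm]
        gcongr
        exact h₂ g hgm
    _ ≤ ENNReal.ofReal (R ^ (b - b₁)) * ENNReal.ofReal C₁ ^ p *
          (C₂ * (ENNReal.ofReal (R ^ (-s₁ - -s)) * ∫⁻ x in Ω, powWeight (-s) x *
            ENNReal.ofReal |Laplacian.laplacian u x| ^ p)) := by
        gcongr
        rw [← lintegral_const_mul' _ _ ENNReal.ofReal_ne_top, ← lintegral_indicator hΩ.measurableSet]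
        refine lintegral_mono_ae ?_
        filter_upwards [ae_ne_zero hn] with x hx0
        by_cases hx : x ∈ Ω
        · rw [Set.indicator_of_mem hx, hg, Set.indicator_of_mem hx, ← mul_assoc]
          gcongr
          exact powWeight_le_mul (by linarith) hx0 (hRn x hx)
        · simp [hg, Set.indicator_of_notMem hx, hp0]
    _ = _ := by ring

lemma eLpNorm_powMeasure_rpow {p : ℝ} (hp : 0 < p) (a : ℝ) (v : EuclideanSpace ℝ (Fin n) → ℝ) :
    eLpNorm v (ENNReal.ofReal p) (powMeasure Ω a) ^ p =
      ∫⁻ x in Ω, powWeight a x * ENNReal.ofReal |v x| ^ p := by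
  have h := eLpNorm_eq_lintegral_rpow_enorm_toReal (f := v) (μ := powMeasure Ω a)
    (p := ENNReal.ofReal p) (by simpa using hp) ENNReal.ofReal_ne_top
  rw [ENNReal.toReal_ofReal hp.le] at h
  rw [h, ← ENNReal.rpow_mul, one_div, inv_mul_cancel₀ hp.ne', ENNReal.rpow_one, powMeasure,
    lintegral_withDensity_eq_lintegral_mul_non_measurable₀ _ (by fun_prop)
      (Eventually.of_forall fun _ => ENNReal.ofReal_lt_top)]
  refine lintegral_congr fun x => ?_
  simp [powWeight, Real.enorm_eq_ofReal_abs]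

lemma lintegral_powWeight_eq {p : ℝ} (hp : 0 < p) (a : ℝ) (v : EuclideanSpace ℝ (Fin n) → ℝ) :
    ∫⁻ x in Ω, ENNReal.ofReal (‖x‖ ^ a * |v x| ^ p) =
      ∫⁻ x in Ω, powWeight a x * ENNReal.ofReal |v x| ^ p := by
  refine lintegral_congr fun x => ?_
  rw [powWeight, ENNReal.ofReal_mul (by positivity), ENNReal.ofReal_rpow_of_nonneg (abs_nonneg _)
    hp.le]

lemma powMeasure_absolutelyContinuous (a : ℝ) : powMeasure Ω a ≪ volume.restrict Ω :=
  withDensity_absolutelyContinuous _ _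

lemma absolutelyContinuous_powMeasure (hn : 1 ≤ n) (a : ℝ) :
    volume.restrict Ω ≪ powMeasure Ω a := by
  refine withDensity_absolutelyContinuous' (by fun_prop) ?_
  filter_upwards [ae_restrict_of_ae (ae_ne_zero hn)] with x hx
  exact (powWeight_pos a hx).ne'

/-- The inequality holds along the approximating sequence. A subsequence converges almost everywhere
by `L¹` convergence, Fatou's lemma handles the left side, and `L^p` convergence of the Laplacians
handles the right. -/
lemma MemNavier.exists_eLpNorm_le (hn : 1 ≤ n) (hΩ : IsOpen Ω)
    (hb' : Bornology.IsBounded Ω) {p s b : ℝ} (hp : 1 < p)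
    (hs : (n : ℝ) - n * p < s) (hb : -(n : ℝ) < b) (hsb : 0 ≤ s + b + 2 * p) :
    ∃ C : ℝ≥0, ∀ u f : EuclideanSpace ℝ (Fin n) → ℝ, MemNavier Ω p s u f →
      eLpNorm u (ENNReal.ofReal p) (powMeasure Ω b) ≤
        C * eLpNorm f (ENNReal.ofReal p) (powMeasure Ω (-s)) := by
  have hp0 : 0 < p := by linarith
  obtain ⟨C₀, hC₀, h₀⟩ := exists_lintegral_le_lintegral_laplacian hn hΩ hb' hp hs hb hsb
  have hC : C₀ ^ p⁻¹ ≠ ⊤ := ENNReal.rpow_ne_top_of_nonneg (by positivity) hC₀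
  have hreg : ∀ v ∈ C2N Ω, eLpNorm v (ENNReal.ofReal p) (powMeasure Ω b) ≤
      C₀ ^ p⁻¹ * eLpNorm (Laplacian.laplacian v) (ENNReal.ofReal p) (powMeasure Ω (-s)) := by
    intro v hv
    rw [← ENNReal.rpow_le_rpow_iff hp0, ENNReal.mul_rpow_of_nonneg _ _ hp0.le, ← ENNReal.rpow_mul,
      inv_mul_cancel₀ hp0.ne', ENNReal.rpow_one, eLpNorm_powMeasure_rpow hp0,
      eLpNorm_powMeasure_rpow hp0]
    exact h₀ v hv
  refine ⟨(C₀ ^ p⁻¹).toNNReal, fun u f ⟨hu, hf, U, hU, hU1, hUf⟩ => ?_⟩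
  rw [ENNReal.coe_toNNReal hC]
  have hmU : ∀ k, AEStronglyMeasurable (U k) (volume.restrict Ω) := fun k =>
    ((hU k).1.1.continuousOn.mono subset_closure).aestronglyMeasurable hΩ.measurableSet
  have hmL : ∀ k, AEStronglyMeasurable (Laplacian.laplacian (U k)) (powMeasure Ω (-s)) := fun k =>
    ((continuousOn_laplacian hΩ (hU k).1).aestronglyMeasurable hΩ.measurableSet).mono_ac
      (powMeasure_absolutelyContinuous _)
  obtain ⟨ns, hns, hae⟩ := (tendstoInMeasure_of_tendsto_eLpNorm one_ne_zero hmU hu.1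
    hU1).exists_seq_tendsto_ae
  have hlim := Lp.eLpNorm_lim_le_liminf_eLpNorm (p := ENNReal.ofReal p) (μ := powMeasure Ω b)
    (f := fun k => U (ns k)) (fun k => (hmU _).mono_ac (powMeasure_absolutelyContinuous _)) u
    ((powMeasure_absolutelyContinuous b).ae_le hae)
  have hbound : ∀ k, eLpNorm (U (ns k)) (ENNReal.ofReal p) (powMeasure Ω b) ≤
      C₀ ^ p⁻¹ * (eLpNorm (fun x => Laplacian.laplacian (U (ns k)) x - f x) (ENNReal.ofReal p)
        (powMeasure Ω (-s)) + eLpNorm f (ENNReal.ofReal p) (powMeasure Ω (-s))) := by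
    intro k
    refine (hreg _ (hU _).1).trans ?_
    gcongr
    have h := eLpNorm_add_le ((hmL (ns k)).sub hf.1) hf.1
      (p := ENNReal.ofReal p) (by simpa using hp.le)
    rw [sub_add_cancel] at h
    exact h
  have ht : Tendsto (fun k => C₀ ^ p⁻¹ * (eLpNorm (fun x => Laplacian.laplacian (U (ns k)) x - f x)
      (ENNReal.ofReal p) (powMeasure Ω (-s)) +
        eLpNorm f (ENNReal.ofReal p) (powMeasure Ω (-s)))) atTop
      (𝓝 (C₀ ^ p⁻¹ * (0 + eLpNorm f (ENNReal.ofReal p) (powMeasure Ω (-s))))) :=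
    ENNReal.Tendsto.const_mul ((hUf.comp hns.tendsto_atTop).add_const _) (Or.inr hC)
  rw [zero_add] at ht
  exact hlim.trans ((liminf_le_liminf (Eventually.of_forall hbound)).trans_eq ht.liminf_eq)

end Embedding

/-! ### Positivity of the infimum and the embedding -/

theorem lemma2p4 (n : ℕ) (hn : 1 ≤ n) (Ω : Set (EuclideanSpace ℝ (Fin n)))
    (hΩ : IsBoundedSmoothDomain Ω) (p s b : ℝ) (hp : 1 < p)
    (hs : (n : ℝ) - n * p < s) (hb : -(n : ℝ) < b) (hsb : 0 ≤ s + b + 2 * p) :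
    0 < rayleighInf Ω p s b ∧
    ∃ C : ℝ≥0, ∀ u f : EuclideanSpace ℝ (Fin n) → ℝ, MemNavier Ω p s u f →
      MemLp u (ENNReal.ofReal p) (powMeasure Ω b) ∧
      eLpNorm u (ENNReal.ofReal p) (powMeasure Ω b) ≤
        C * eLpNorm f (ENNReal.ofReal p) (powMeasure Ω (-s)) := by
  have hp0 : 0 < p := by linarith
  obtain ⟨C, hC⟩ := MemNavier.exists_eLpNorm_le hn hΩ.isOpen hΩ.isBounded hp hs hb hsb
  have hmem : ∀ u f : EuclideanSpace ℝ (Fin n) → ℝ, MemNavier Ω p s u f →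
      MemLp u (ENNReal.ofReal p) (powMeasure Ω b) := fun u f h =>
    ⟨h.1.1.mono_ac (powMeasure_absolutelyContinuous b),
      (hC u f h).trans_lt (ENNReal.mul_lt_top ENNReal.coe_lt_top h.2.1.2)⟩
  refine ⟨?_, C, fun u f h => ⟨hmem u f h, hC u f h⟩⟩
  have hCp : (C : ℝ≥0∞) ^ p ≠ ⊤ := ENNReal.rpow_ne_top_of_nonneg hp0.le ENNReal.coe_ne_top
  -- The embedding constant gives the explicit lower bound `C^{-p}` for every quotient.
  refine lt_of_lt_of_le (ENNReal.inv_pos.2 hCp) (le_iInf fun u => le_iInf fun f => le_iInf fun h =>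
    le_iInf fun hu => ?_)
  rw [lintegral_powWeight_eq hp0, lintegral_powWeight_eq hp0, ← eLpNorm_powMeasure_rpow hp0,
    ← eLpNorm_powMeasure_rpow hp0]
  have hle : eLpNorm u (ENNReal.ofReal p) (powMeasure Ω b) ^ p ≤
      (C : ℝ≥0∞) ^ p * eLpNorm f (ENNReal.ofReal p) (powMeasure Ω (-s)) ^ p := by
    rw [← ENNReal.mul_rpow_of_nonneg _ _ hp0.le]
    exact ENNReal.rpow_le_rpow (hC u f h) hp0.le
  -- The weight is positive almost everywhere, so a zero weighted norm would force `u = 0` almost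
  -- everywhere in `Ω`.
  have hne : eLpNorm u (ENNReal.ofReal p) (powMeasure Ω b) ^ p ≠ 0 := by
    intro h0
    have h1 := (ENNReal.rpow_eq_zero_iff_of_pos hp0).1 h0
    rw [eLpNorm_eq_zero_iff (hmem u f h).1 (by simpa using hp0)] at h1
    exact hu ((absolutelyContinuous_powMeasure hn b).ae_le h1)
  have hfin : eLpNorm u (ENNReal.ofReal p) (powMeasure Ω b) ^ p ≠ ⊤ :=
    ENNReal.rpow_ne_top_of_nonneg hp0.le (hmem u f h).2.ne
  rw [ENNReal.le_div_iff_mul_le (Or.inl hne) (Or.inl hfin), mul_comm, ← div_eq_mul_inv]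
  exact ENNReal.div_le_of_le_mul' hle
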